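/- **Model.** The input consists of $n$ non-vertical lines $\ell_1,\dots,\ell_n$ in the plane, $\ell_i=\{y=a_ix+b_i\}$, numbered by increasing slope, $a_1<\dots<a_n$ (so an algorithm knows the slope order for free), no three of them having a common point. The *orientation test* of three distinct lines $\ell_i,\ell_j,\ell_k$ is $$\operatorname{sign}\det\begin{pmatrix}1&a_i&b_i\\1&a_j&b_j\\1&a_k&b_k\end{pmatrix},$$ the orientation of the three dual points; for $i<j<k$ it tells whether the crossing point of $\ell_i$ and $\ell_k$ lies above or below $\ell_j$. Each call to the *noisy* orientation test returns, independently of all other calls (including repetitions of the same call), the reversed orientation with probability $p$ and the correct one with probability $1-p$. A randomized algorithm accesses the lines only through adaptively chosen calls to the noisy test; all other computation is free and unrestricted, and may use a random seed independent of the noise. It *constructs the arrangement* if it halts and outputs the complete labelled combinatorial structure of the arrangement, that is, the set of the position vectors (above / on / below each $\ell_i$) of all vertices, edges and cells. **Theorem.** Let $0<p<\tfrac12$ and $c>0$. There are $\kappa>0$ and $N$, depending only on $p$ and $c$, such that for all $n\ge N$: every randomized algorithm that, on each such input of $n$ lines, constructs the arrangement with probability at least $1-n^{-c}$, makes on some such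 input an expected number of at least $\kappa\,n^2\log n$ calls to the noisy orientation test. Hence constructing an arrangement of $n$ lines with high probability requires $\Omega(n^2\log n)$ calls, even for the expected number of calls of a randomized algorithm. -/

import Mathlib

open MeasureTheory

namespace NoisyArrangement

/-- A non-vertical line `y = slope * x + intercept` in the Euclidean plane. -/
structure Line where
  slope : ℝ
  intercept : ℝ

/-- The position of the point `z` relative to the line `l`:
`1` if `z` is above `l`, `0` if it is on `l`, `-1` if it is below `l`. -/
noncomputable def Line.side (l : Line) (z : ℝ × ℝ) : SignType :=
  SignType.sign (z.2 - (l.slope * z.1 + l.intercept))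

/-- The arrangement of the labelled lines `L`. Each face of the subdivision of the plane by the
lines (each vertex, edge and cell) is recorded by its position vector, which says for every line
whether the face lies above, on or below it. A face lies in the closure of another one iff its
position vector is obtained from the other one by replacing some entries by `0`, so this set is the
complete labelled combinatorial structure of the arrangement. -/
def arrangement {n : ℕ} (L : Fin n → Line) : Set (Fin n → SignType) :=
  Set.range fun (z : ℝ × ℝ) (i : Fin n) => (L i).side z

/-- The lines `L` are numbered by increasing slope (in particular no two of them are parallel), and
no three of them have a common point. -/
structure IsSimpleSorted {n : ℕ} (L : Fin n → Line) : Prop where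
  strictMono_slope : StrictMono fun i => (L i).slope
  not_concurrent : ∀ q : Fin 3 ↪ Fin n, ¬ ∃ z : ℝ × ℝ, ∀ r, (L (q r)).side z = 0

/-- The exact orientation test for the three distinct lines with indices `q 0`, `q 1`, `q 2`:
the orientation of the three points `(slope, intercept)` dual to the lines. -/
noncomputable def orientation {n : ℕ} (L : Fin n → Line) (q : Fin 3 ↪ Fin n) : SignType :=
  SignType.sign
    (Matrix.det (Matrix.of fun r : Fin 3 => ![1, (L (q r)).slope, (L (q r)).intercept]))

/-- For lines of pairwise different slopes, the orientation test returns `0` exactly when the three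
lines meet in a point. -/
theorem orientation_eq_zero_iff {n : ℕ} (L : Fin n → Line) (q : Fin 3 ↪ Fin n)
    (h : Function.Injective fun i => (L i).slope) :
    orientation L q = 0 ↔ ∃ z : ℝ × ℝ, ∀ r, (L (q r)).side z = 0 := by
  have h01 : (L (q 1)).slope - (L (q 0)).slope ≠ 0 := fun e =>
    absurd (q.injective (h (sub_eq_zero.mp e))) (by decide)
  simp only [orientation, Line.side, sign_eq_zero_iff, Matrix.det_fin_three, Matrix.of_apply,
    Fin.forall_fin_succ, Matrix.cons_val, IsEmpty.forall_iff, and_true, Fin.succ_zero_eq_one,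
    Fin.succ_one_eq_two]
  constructor
  · intro e
    refine ⟨(-((L (q 1)).intercept - (L (q 0)).intercept) / ((L (q 1)).slope - (L (q 0)).slope),
      (L (q 0)).slope * (-((L (q 1)).intercept - (L (q 0)).intercept) /
        ((L (q 1)).slope - (L (q 0)).slope)) + (L (q 0)).intercept), ?_, ?_, ?_⟩
    · ring
    · field_simp
      ring
    · field_simp
      linear_combination -e
  · rintro ⟨z, h0, h1, h2⟩
    linear_combination
      ((L (q 1)).slope - (L (q 2)).slope) * h0 + ((L (q 2)).slope - (L (q 0)).slope) * h1
        + ((L (q 0)).slope - (L (q 1)).slope) * h2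

/-- For three lines in increasing order of slope, the orientation test tells on which side of the
second line the crossing point of the other two lies. -/
theorem orientation_eq_side {n : ℕ} (L : Fin n → Line) (q : Fin 3 ↪ Fin n) (z : ℝ × ℝ)
    (h01 : (L (q 0)).slope < (L (q 1)).slope) (h12 : (L (q 1)).slope < (L (q 2)).slope)
    (h0 : (L (q 0)).side z = 0) (h2 : (L (q 2)).side z = 0) :
    orientation L q = (L (q 1)).side z := by
  have hpos : 0 < (L (q 2)).slope - (L (q 0)).slope := by linarith
  simp only [Line.side, sign_eq_zero_iff] at h0 h2
  rw [orientation, Line.side, ← one_mul (SignType.sign (z.2 - _)), ← sign_pos hpos, ← sign_mul]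
  congr 1
  simp only [Matrix.det_fin_three, Matrix.of_apply, Matrix.cons_val]
  linear_combination
    ((L (q 1)).slope - (L (q 2)).slope) * h0 + ((L (q 0)).slope - (L (q 1)).slope) * h2

/-- The noisy orientation test: if the error bit `b` is set, then the wrong answer (the reversed
orientation) is returned, otherwise the correct one. -/
noncomputable def noisyOrientation {n : ℕ} (L : Fin n → Line) (b : Bool) (q : Fin 3 ↪ Fin n) :
    SignType :=
  if b then -orientation L q else orientation L q

/-- What an algorithm can do next: call the orientation test on three distinct lines, or halt with
an output. -/
inductive Action (n : ℕ) where
  | call (q : Fin 3 ↪ Fin n)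
  | halt (out : Set (Fin n → SignType))

/-- A deterministic algorithm for `n` lines: an arbitrary function that chooses the next action from
the answers received so far (latest answer first). The only access to the lines is through the
answers; all other computation is free and unrestricted. -/
abbrev DetAlgorithm (n : ℕ) := List SignType → Action n

/-- The answers received after the first `t` calls (or up to halting, if that happens before), when
the error bit of the `t`-th call is `e t`. -/
noncomputable def answers {n : ℕ} (A : DetAlgorithm n) (L : Fin n → Line) (e : ℕ → Bool) :
    ℕ → List SignType
  | 0 => []
  | t + 1 =>
    match A (answers A L e t) with
    | .call q => noisyOrientation L (e t) q :: answers A L e t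
    | .halt _ => answers A L e t

/-- The algorithm halts after finitely many calls, with output `out`. -/
def HaltsWith {n : ℕ} (A : DetAlgorithm n) (L : Fin n → Line) (e : ℕ → Bool)
    (out : Set (Fin n → SignType)) : Prop :=
  ∃ t, A (answers A L e t) = .halt out

open Classical in
/-- The number of calls to the noisy test, `∞` if the algorithm does not halt. -/
noncomputable def numCalls {n : ℕ} (A : DetAlgorithm n) (L : Fin n → Line) (e : ℕ → Bool) :
    ENNReal :=
  ∑' t, if ∃ q, A (answers A L e t) = .call q then 1 else 0

/-- A randomized algorithm: a deterministic algorithm that depends on a random seed `ω`. -/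
structure RandAlgorithm (n : ℕ) (Ω : Type*) [MeasurableSpace Ω] where
  alg : Ω → DetAlgorithm n
  measurable_alg : ∀ h a, MeasurableSet {ω | alg ω h = a}

/-- The law of the error bits: independent, each of them set with probability `p`. -/
noncomputable def errorLaw (p : unitInterval) : Measure (ℕ → Bool) :=
  Measure.infinitePi fun _ => ProbabilityTheory.bernoulliMeasure true false p

/-- The probability that the algorithm, run on the lines `L` with a seed of law `μ` and independent
error bits, halts and outputs the arrangement of `L`. -/
noncomputable def successProb {n : ℕ} {Ω : Type*} [MeasurableSpace Ω] (μ : Measure Ω)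
    (p : unitInterval) (R : RandAlgorithm n Ω) (L : Fin n → Line) : ℝ :=
  (μ.prod (errorLaw p)).real {x | HaltsWith (R.alg x.1) L x.2 (arrangement L)}

/-- The expected number of calls to the noisy test when the algorithm is run on the lines `L`. -/
noncomputable def expectedCalls {n : ℕ} {Ω : Type*} [MeasurableSpace Ω] (μ : Measure Ω)
    (p : unitInterval) (R : RandAlgorithm n Ω) (L : Fin n → Line) : ENNReal :=
  ∫⁻ x, numCalls (R.alg x.1) L x.2 ∂(μ.prod (errorLaw p))

end NoisyArrangement

namespace NoisyArrangement

/-! The hard input is the dual of a point set with quadratically many almost collinear triples.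
Three points of the cubic `y = 3 x ^ 3` are collinear exactly when their abscissae sum to zero.
Integer abscissae in three blocks give about `m ^ 2` such triples, one point per block, with `m`
about `n / 4`. A vertical shift by at most one resolves all of them and leaves every other
orientation unchanged. The base instance orients all these triples negatively. For each pair `(a,
b)` with `a, b < m`, another choice of shifts reverses exactly one of them (`orientation_base`,
`orientation_flip`). So the base has `m ^ 2` neighbours with different arrangements, which differ
from it on pairwise disjoint sets of calls (`eq_of_mem_flippedTriples`).

To tell the base from one neighbour, only calls on the reversed triple help. Each such call changes
the likelihood of a transcript by a factor of at least `r = p / (1 - p)`, so a transcript with fewer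
than `K` of them is at least `r ^ K` times as likely on the neighbour (`transcript_likelihood`,
`haltsWith_likelihood`). If the algorithm usually answered correctly on the base with fewer than `K`
such calls, it would output the wrong arrangement on the neighbour with probability at least `r ^ K
/ 2`. For `K` a small multiple of `log n` this exceeds `n ^ (-c)`. Hence with probability at least
`1 / 4` there are `K` calls on each reversed triple (`quarter_le_prob_numCallsOn`). Every call
counts for at most one neighbour, so the expectations add up to `m ^ 2 * K / 4`
(`card_mul_le_expectedCalls`). -/

/-! ### Orientations, permutations of a triple, and the arrangement. -/

theorem orientation_comp_perm {n : ℕ} (L : Fin n → Line) (q : Fin 3 ↪ Fin n)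
    (σ : Equiv.Perm (Fin 3)) :
    orientation L (σ.toEmbedding.trans q) =
      SignType.sign (((Equiv.Perm.sign σ : ℤˣ) : ℤ) : ℝ) * orientation L q := by
  rw [orientation, orientation, ← sign_mul, ← Matrix.det_permute]
  rfl

theorem exists_strictMono_comp_perm {n : ℕ} (q : Fin 3 ↪ Fin n) :
    ∃ σ : Equiv.Perm (Fin 3), StrictMono (σ.toEmbedding.trans q) :=
  ⟨Tuple.sort q, (Tuple.monotone_sort q).strictMono_of_injective
    ((Tuple.sort q).toEmbedding.trans q).injective⟩

/-- The arrangement determines the orientations of all triples in increasing order of slope. -/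
theorem orientation_eq_of_arrangement_eq {n : ℕ} {L L' : Fin n → Line}
    (h : StrictMono fun i => (L i).slope) (h' : StrictMono fun i => (L' i).slope)
    (e : arrangement L = arrangement L') (q : Fin 3 ↪ Fin n) (hq : StrictMono q) :
    orientation L q = orientation L' q := by
  have h02 : (L (q 2)).slope - (L (q 0)).slope ≠ 0 :=
    (sub_pos.2 (h (hq (by decide : (0 : Fin 3) < 2)))).ne'
  obtain ⟨z, hz0, hz2⟩ : ∃ z, (L (q 0)).side z = 0 ∧ (L (q 2)).side z = 0 := by
    refine ⟨(-((L (q 2)).intercept - (L (q 0)).intercept) / ((L (q 2)).slope - (L (q 0)).slope),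
      (L (q 0)).slope * (-((L (q 2)).intercept - (L (q 0)).intercept) /
        ((L (q 2)).slope - (L (q 0)).slope)) + (L (q 0)).intercept), ?_, ?_⟩
    · simp [Line.side]
    · simp only [Line.side, sign_eq_zero_iff]
      field_simp
      ring
  -- The position vector of the crossing of the outer two lines also occurs in the other
  -- arrangement, necessarily at the corresponding crossing; its middle entry is the orientation.
  obtain ⟨z', hz'⟩ : (fun i => (L i).side z) ∈ arrangement L' := e ▸ ⟨z, rfl⟩
  have hs : ∀ i, (L' i).side z' = (L i).side z := fun i => congrFun hz' i
  rw [orientation_eq_side L q z (h (hq (by decide))) (h (hq (by decide))) hz0 hz2,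
    orientation_eq_side L' q z' (h' (hq (by decide))) (h' (hq (by decide)))
      ((hs _).trans hz0) ((hs _).trans hz2), hs]

/-! ### The hard instances: perturbed points on a cubic. -/

/-- The slopes of the hard instances: three blocks of consecutive integers, close to `-30 n`,
`10 n` and `20 n`, the first two of size `m`. -/
def blockSlope (n m : ℕ) (i : Fin n) : ℤ :=
  if (i : ℕ) < m then -30 * n - 2 * m + i else if (i : ℕ) < 2 * m then 10 * n + i - m
  else 20 * n + i - 2 * m

theorem blockSlope_strictMono (n m : ℕ) (h : 4 * m + 1 ≤ n) : StrictMono (blockSlope n m) := by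
  intro i j hij
  have : (i : ℕ) < j := hij
  have := j.2
  unfold blockSlope
  split_ifs <;> omega

/-- Lines dual to the points of the cubic `y = 3 x ^ 3` with abscissae `blockSlope n m`, shifted
vertically by `s`. -/
def cubicLines (n m : ℕ) (s : Fin n → ℤ) (i : Fin n) : Line where
  slope := blockSlope n m i
  intercept := ((3 * blockSlope n m i ^ 3 + s i : ℤ) : ℝ)

theorem orientation_cubicLines (n m : ℕ) (s : Fin n → ℤ) (q : Fin 3 ↪ Fin n) :
    orientation (cubicLines n m s) q =
      SignType.sign (3 * ((blockSlope n m (q 1) - blockSlope n m (q 0)) *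
          (blockSlope n m (q 2) - blockSlope n m (q 0)) *
          (blockSlope n m (q 2) - blockSlope n m (q 1))) *
          (blockSlope n m (q 0) + blockSlope n m (q 1) + blockSlope n m (q 2)) +
        ((blockSlope n m (q 2) - blockSlope n m (q 1)) * s (q 0) -
          (blockSlope n m (q 2) - blockSlope n m (q 0)) * s (q 1) +
          (blockSlope n m (q 1) - blockSlope n m (q 0)) * s (q 2))) := by
  rw [orientation, ← sign_intCast (α := ℝ)]
  congr 1
  simp only [Matrix.det_fin_three, Matrix.of_apply, Matrix.cons_val, cubicLines]
  push_cast
  ring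

/-- By integrality the unperturbed determinant is at least `3 * (z - x)` in absolute value, while
the shifts contribute at most `(z - y) + (z - x) + (y - x) = 2 * (z - x)`. The coefficient 3 of the
cubic is there for this margin. -/
theorem sign_cubic_of_sum_ne_zero {x y z u v w : ℤ} (hxy : x < y) (hyz : y < z)
    (hu : |u| ≤ 1) (hv : |v| ≤ 1) (hw : |w| ≤ 1) (h : x + y + z ≠ 0) :
    SignType.sign (3 * ((y - x) * (z - x) * (z - y)) * (x + y + z) +
      ((z - y) * u - (z - x) * v + (y - x) * w)) = SignType.sign (x + y + z) := by
  rw [abs_le] at hu hv hw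
  have hV : z - x ≤ (y - x) * (z - x) * (z - y) := by
    have h1 : 1 ≤ (y - x) * (z - y) := by nlinarith
    nlinarith
  have e1 : (z - y) * u ≤ z - y := by nlinarith
  have e2 : -(z - y) ≤ (z - y) * u := by nlinarith
  have e3 : (z - x) * v ≤ z - x := by nlinarith
  have e4 : -(z - x) ≤ (z - x) * v := by nlinarith
  have e5 : (y - x) * w ≤ y - x := by nlinarith
  have e6 : -(y - x) ≤ (y - x) * w := by nlinarith
  rcases lt_or_gt_of_ne h with h | h
  · rw [sign_neg h, sign_neg]
    have : 3 * ((y - x) * (z - x) * (z - y)) * (x + y + z) ≤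
      3 * ((y - x) * (z - x) * (z - y)) * (-1) := by
      apply mul_le_mul_of_nonneg_left <;> linarith
    linarith
  · rw [sign_pos h, sign_pos]
    have : 3 * ((y - x) * (z - x) * (z - y)) * 1 ≤
      3 * ((y - x) * (z - x) * (z - y)) * (x + y + z) := by
      apply mul_le_mul_of_nonneg_left <;> linarith
    linarith

/-- The vertical shifts of the base instance. -/
def baseShift (n m : ℕ) (i : Fin n) : ℤ :=
  if (i : ℕ) < m then 0 else if (i : ℕ) < 2 * m then 1 else 0

/-- The vertical shifts of the instance in which the triple of `a`, `m + b` and `4 m - a - b` is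
reversed. -/
def flipShift (n m a b : ℕ) (i : Fin n) : ℤ :=
  if (i : ℕ) < m then (if (i : ℕ) = a then 1 else -1)
  else if (i : ℕ) < 2 * m then (if (i : ℕ) = m + b then 0 else 1) else 0

theorem abs_baseShift_le (n m : ℕ) (i : Fin n) : |baseShift n m i| ≤ 1 := by
  unfold baseShift
  split_ifs <;> simp

theorem abs_flipShift_le (n m a b : ℕ) (i : Fin n) : |flipShift n m a b i| ≤ 1 := by
  unfold flipShift
  split_ifs <;> simp

/-- Only `-30 n + 10 n + 20 n` cancels; any other choice of blocks leaves a multiple of `n` that the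
offsets cannot compensate. With one index per block the sum is `i + j + k - 5 m`. -/
theorem blocks_of_sum_eq_zero {n m : ℕ} {i j k : Fin n} (hij : i < j)
    (hjk : j < k) (hs : blockSlope n m i + blockSlope n m j + blockSlope n m k = 0) :
    (i : ℕ) < m ∧ m ≤ (j : ℕ) ∧ (j : ℕ) < 2 * m ∧ 2 * m ≤ (k : ℕ) ∧ (i + j + k : ℕ) = 5 * m := by
  have : (i : ℕ) < j := hij
  have : (j : ℕ) < k := hjk
  have := k.2
  unfold blockSlope at hs
  split_ifs at hs <;> omega

/-- The sum of the abscissae of the points dual to three lines; it vanishes iff the points on the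
cubic are collinear. -/
def slopeSum (n m : ℕ) (q : Fin 3 ↪ Fin n) : ℤ :=
  blockSlope n m (q 0) + blockSlope n m (q 1) + blockSlope n m (q 2)

theorem orientation_base {n m : ℕ} (h : 4 * m + 1 ≤ n) (q : Fin 3 ↪ Fin n) (hq : StrictMono q) :
    orientation (cubicLines n m (baseShift n m)) q =
      if slopeSum n m q = 0 then -1 else SignType.sign (slopeSum n m q) := by
  have h01 : q 0 < q 1 := hq (by decide)
  have h12 : q 1 < q 2 := hq (by decide)
  have hxy := blockSlope_strictMono n m h h01
  have hyz := blockSlope_strictMono n m h h12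
  rw [orientation_cubicLines]
  split_ifs with hu
  · obtain ⟨h1, h2, h3, h4, -⟩ := blocks_of_sum_eq_zero h01 h12 hu
    rw [slopeSum] at hu
    rw [hu, sign_neg]
    -- For a collinear triple only the shift term survives; with shifts 0, 1, 0 it is `-(z - x)`,
    -- where `x < y < z` are the abscissae.
    simp only [baseShift, h1, h2.not_gt, h3, h4.not_gt, if_true, if_false,
      show ¬ (q 2 : ℕ) < m by omega]
    linarith
  · exact sign_cubic_of_sum_ne_zero hxy hyz (abs_baseShift_le ..) (abs_baseShift_le ..)
      (abs_baseShift_le ..) hu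

theorem orientation_flip {n m : ℕ} (h : 4 * m + 1 ≤ n) (a b : ℕ) (q : Fin 3 ↪ Fin n)
    (hq : StrictMono q) :
    orientation (cubicLines n m (flipShift n m a b)) q =
      if slopeSum n m q = 0 then (if (q 0 : ℕ) = a ∧ (q 1 : ℕ) = m + b then 1 else -1)
      else SignType.sign (slopeSum n m q) := by
  have h01 : q 0 < q 1 := hq (by decide)
  have h12 : q 1 < q 2 := hq (by decide)
  have hxy := blockSlope_strictMono n m h h01
  have hyz := blockSlope_strictMono n m h h12
  rw [orientation_cubicLines]
  split_ifs with hu hab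
  · obtain ⟨h1, h2, h3, h4, -⟩ := blocks_of_sum_eq_zero h01 h12 hu
    rw [slopeSum] at hu
    rw [hu, sign_pos]
    rw [hab.1] at h1
    rw [hab.2] at h2 h3
    -- Shifts 1, 0, 0 give `z - y > 0`.
    simp only [flipShift, hab.1, hab.2, h1, h2.not_gt, h3, h4.not_gt, if_true, if_false,
      show ¬ (q 2 : ℕ) < m by omega]
    linarith
  · obtain ⟨h1, h2, h3, h4, -⟩ := blocks_of_sum_eq_zero h01 h12 hu
    rw [slopeSum] at hu
    rw [hu, sign_neg]
    simp only [flipShift, h1, h2.not_gt, h3, h4.not_gt, if_true, if_false,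
      show ¬ (q 2 : ℕ) < m by omega]
    -- With only `a` matching, the shift term is `(z - y) - (z - x) = -(y - x)`; with only `b`
    -- matching, it is `-(z - y)`; with neither, it is `-(z - y) - (z - x)`. All are negative.
    split_ifs <;> first | linarith | (exfalso; tauto)
  · exact sign_cubic_of_sum_ne_zero hxy hyz (abs_flipShift_le ..) (abs_flipShift_le ..)
      (abs_flipShift_le ..) hu

theorem cubicLines_slope_strictMono {n m : ℕ} (h : 4 * m + 1 ≤ n) (s : Fin n → ℤ) :
    StrictMono fun i => (cubicLines n m s i).slope := fun i j hij => by
  simpa [cubicLines] using blockSlope_strictMono n m h hij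

theorem isSimpleSorted_of_orientation_ne_zero {n : ℕ} {L : Fin n → Line}
    (hL : StrictMono fun i => (L i).slope)
    (h : ∀ q : Fin 3 ↪ Fin n, StrictMono q → orientation L q ≠ 0) : IsSimpleSorted L := by
  refine ⟨hL, fun q => ?_⟩
  rw [← orientation_eq_zero_iff L q hL.injective]
  intro e
  obtain ⟨σ, hσ⟩ := exists_strictMono_comp_perm q
  exact h _ hσ (by rw [orientation_comp_perm, e, mul_zero])

theorem IsSimpleSorted.orientation_ne_zero {n : ℕ} {L : Fin n → Line} (h : IsSimpleSorted L)
    (q : Fin 3 ↪ Fin n) : orientation L q ≠ 0 := fun e =>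
  h.not_concurrent q ((orientation_eq_zero_iff L q h.strictMono_slope.injective).1 e)

theorem isSimpleSorted_base {n m : ℕ} (h : 4 * m + 1 ≤ n) :
    IsSimpleSorted (cubicLines n m (baseShift n m)) := by
  refine isSimpleSorted_of_orientation_ne_zero (cubicLines_slope_strictMono h _) fun q hq => ?_
  rw [orientation_base h q hq]
  intro e
  split_ifs at e with hu
  exact hu (sign_eq_zero_iff.1 e)

theorem isSimpleSorted_flip {n m : ℕ} (h : 4 * m + 1 ≤ n) (a b : ℕ) :
    IsSimpleSorted (cubicLines n m (flipShift n m a b)) := by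
  refine isSimpleSorted_of_orientation_ne_zero (cubicLines_slope_strictMono h _) fun q hq => ?_
  rw [orientation_flip h a b q hq]
  intro e
  split_ifs at e with hu
  exact hu (sign_eq_zero_iff.1 e)

theorem arrangement_base_ne_flip {n m : ℕ} (h : 4 * m + 1 ≤ n) {a b : ℕ} (ha : a < m)
    (hb : b < m) :
    arrangement (cubicLines n m (baseShift n m)) ≠
      arrangement (cubicLines n m (flipShift n m a b)) := by
  intro e
  -- The third index makes the indices sum to `5 m`; it lies between `2 m` and `4 m`, which is where
  -- `4 * m + 1 ≤ n` is needed.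
  have hq : StrictMono ![(⟨a, by omega⟩ : Fin n), ⟨m + b, by omega⟩, ⟨4 * m - a - b, by omega⟩] := by
    rw [Fin.strictMono_iff_lt_succ]
    intro i
    fin_cases i <;> simp [Fin.lt_def] <;> omega
  have := orientation_eq_of_arrangement_eq (cubicLines_slope_strictMono h _)
    (cubicLines_slope_strictMono h _) e ⟨_, hq.injective⟩ hq
  have hs : slopeSum n m ⟨_, hq.injective⟩ = 0 := by
    simp only [slopeSum, blockSlope, Function.Embedding.coeFn_mk, Matrix.cons_val]
    omega
  rw [orientation_base h _ hq, orientation_flip h a b _ hq, if_pos hs, if_pos hs,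
    if_pos (by simp)] at this
  cases this

/-- The triples on which the base instance and a flipped instance differ. -/
def flippedTriples (n m a b : ℕ) : Set (Fin 3 ↪ Fin n) :=
  {q | orientation (cubicLines n m (baseShift n m)) q ≠
    orientation (cubicLines n m (flipShift n m a b)) q}

theorem eq_of_mem_flippedTriples {n m : ℕ} (h : 4 * m + 1 ≤ n) {a b a' b' : ℕ}
    {q : Fin 3 ↪ Fin n} (hq : q ∈ flippedTriples n m a b) (hq' : q ∈ flippedTriples n m a' b') :
    (a, b) = (a', b') := by
  obtain ⟨σ, hσ⟩ := exists_strictMono_comp_perm q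
  -- Sorting the triple multiplies both orientations by the same sign, so a difference persists, and
  -- a sorted triple on which they differ reveals `a` and `b`.
  have key : ∀ a b : ℕ, q ∈ flippedTriples n m a b →
      ((σ.toEmbedding.trans q) 0 : ℕ) = a ∧ ((σ.toEmbedding.trans q) 1 : ℕ) = m + b := by
    intro a b hab
    by_contra hne
    have h1 := orientation_base h _ hσ
    have h2 := orientation_flip h a b _ hσ
    rw [if_neg hne] at h2
    rw [← h2, orientation_comp_perm, orientation_comp_perm] at h1
    refine hab (mul_left_cancel₀ ?_ h1)
    simp [sign_eq_zero_iff]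
  have h1 := key a b hq
  have h2 := key a' b' hq'
  simp only [Prod.mk.injEq]
  omega

/-! ### Transcripts of a run and their dependence on the error bits. -/

section Transcripts

variable {n : ℕ}

theorem answers_succ_of_call {A : DetAlgorithm n} {L : Fin n → Line} {e : ℕ → Bool} {t : ℕ}
    {q : Fin 3 ↪ Fin n} (h : A (answers A L e t) = .call q) :
    answers A L e (t + 1) = noisyOrientation L (e t) q :: answers A L e t := by
  rw [answers, h]

theorem answers_succ_of_halt {A : DetAlgorithm n} {L : Fin n → Line} {e : ℕ → Bool} {t : ℕ}
    {out : Set (Fin n → SignType)} (h : A (answers A L e t) = .halt out) :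
    answers A L e (t + 1) = answers A L e t := by
  rw [answers, h]

theorem answers_eq_of_halt {A : DetAlgorithm n} {L : Fin n → Line} {e : ℕ → Bool} {t : ℕ}
    {out : Set (Fin n → SignType)} (h : A (answers A L e t) = .halt out) {s : ℕ} (hs : t ≤ s) :
    answers A L e s = answers A L e t := by
  induction s, hs using Nat.le_induction with
  | base => rfl
  | succ s hs ih => rw [answers_succ_of_halt (out := out) (by rw [ih, h]), ih]

theorem length_answers_of_call {A : DetAlgorithm n} {L : Fin n → Line} {e : ℕ → Bool} {t : ℕ}
    {q : Fin 3 ↪ Fin n} (h : A (answers A L e t) = .call q) :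
    (answers A L e t).length = t := by
  induction t generalizing q with
  | zero => rfl
  | succ t ih =>
    cases h' : A (answers A L e t) with
    | call q' => rw [answers_succ_of_call h', List.length_cons, ih h']
    | halt out =>
      rw [answers_succ_of_halt h', h'] at h
      cases h

theorem length_answers_le (A : DetAlgorithm n) (L : Fin n → Line) (e : ℕ → Bool) (t : ℕ) :
    (answers A L e t).length ≤ t := by
  induction t with
  | zero => exact le_rfl
  | succ t ih =>
    cases h' : A (answers A L e t) with
    | call q' => simpa [answers_succ_of_call h'] using ih
    | halt out => exact (answers_succ_of_halt h').symm ▸ ih.trans t.le_succ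

/-- A transcript stops growing at halting, so it is already present at the time equal to its length.
Events can thus be indexed by transcripts alone, as in `haltsWith_iff`, without a halting time. -/
theorem answers_length_answers (A : DetAlgorithm n) (L : Fin n → Line) (e : ℕ → Bool) (t : ℕ) :
    answers A L e (answers A L e t).length = answers A L e t := by
  induction t with
  | zero => rfl
  | succ t ih =>
    cases h' : A (answers A L e t) with
    | call q' =>
      rw [answers_succ_of_call h', List.length_cons, length_answers_of_call h',
        answers_succ_of_call h']
    | halt out => rw [answers_succ_of_halt h', ih]

theorem haltsWith_iff {A : DetAlgorithm n} {L : Fin n → Line} {e : ℕ → Bool}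
    {out : Set (Fin n → SignType)} :
    HaltsWith A L e out ↔ ∃ h, A h = .halt out ∧ answers A L e h.length = h :=
  ⟨fun ⟨t, ht⟩ => ⟨_, ht, answers_length_answers A L e t⟩, fun ⟨_, h1, h2⟩ => ⟨_, h2.symm ▸ h1⟩⟩

theorem answers_eq_answers_of_halt {A : DetAlgorithm n} {L : Fin n → Line} {e : ℕ → Bool}
    {s t : ℕ} {out out' : Set (Fin n → SignType)} (hs : A (answers A L e s) = .halt out)
    (ht : A (answers A L e t) = .halt out') : answers A L e s = answers A L e t := by
  rcases le_total s t with h | h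
  · exact (answers_eq_of_halt hs h).symm
  · exact answers_eq_of_halt ht h

theorem HaltsWith.unique {A : DetAlgorithm n} {L : Fin n → Line} {e : ℕ → Bool}
    {out out' : Set (Fin n → SignType)} (h : HaltsWith A L e out) (h' : HaltsWith A L e out') :
    out = out' := by
  obtain ⟨s, hs⟩ := h
  obtain ⟨t, ht⟩ := h'
  rw [answers_eq_answers_of_halt hs ht, ht] at hs
  exact (Action.halt.inj hs).symm

theorem answers_congr (A : DetAlgorithm n) (L : Fin n → Line) {e e' : ℕ → Bool} {t : ℕ}
    (h : ∀ i < t, e i = e' i) : answers A L e t = answers A L e' t := by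
  induction t with
  | zero => rfl
  | succ t ih =>
    rw [answers, answers, ih fun i hi => h i (hi.trans t.lt_succ_self), h t t.lt_succ_self]

theorem noisyOrientation_injective {L : Fin n → Line} {q : Fin 3 ↪ Fin n}
    (h : orientation L q ≠ 0) : Function.Injective fun b => noisyOrientation L b q := by
  intro b b' e
  revert e h
  simp only [noisyOrientation]
  generalize orientation L q = o
  revert b b' o
  decide

/-- Equal answers lead to the same next call, and the answer to a call with nonzero orientation
reveals its error bit. Hence a transcript event lies in a single cylinder of error bits. -/
theorem eq_of_answers_eq {A : DetAlgorithm n} {L : Fin n → Line} (hL : ∀ q, orientation L q ≠ 0)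
    {e e' : ℕ → Bool} {t : ℕ} (hlen : (answers A L e t).length = t)
    (h : answers A L e t = answers A L e' t) : ∀ i < t, e i = e' i := by
  induction t with
  | zero => simp
  | succ t ih =>
    have hcall : ∀ e, (answers A L e (t + 1)).length = t + 1 →
        ∃ q, A (answers A L e t) = .call q := by
      intro e he
      cases h' : A (answers A L e t) with
      | call q => exact ⟨q, rfl⟩
      | halt out =>
        rw [answers_succ_of_halt h'] at he
        have := length_answers_le A L e t
        omega
    obtain ⟨q, hq⟩ := hcall e hlen
    obtain ⟨q', hq'⟩ := hcall e' (h ▸ hlen)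
    rw [answers_succ_of_call hq, answers_succ_of_call hq', List.cons.injEq] at h
    have hqq : q = q' := Action.call.inj (by rw [← hq, ← hq', h.2])
    subst hqq
    intro i hi
    rcases Nat.lt_succ_iff_lt_or_eq.1 hi with hi | rfl
    · exact ih (length_answers_of_call hq) h.2 i hi
    · exact noisyOrientation_injective (hL q) h.1

/-- The error bits that make the algorithm receive on `L'` the answers that it receives on `L`
with the error bits `e`. -/
noncomputable def transferBits (A : DetAlgorithm n) (L L' : Fin n → Line) (e : ℕ → Bool) (t : ℕ) :
    Bool :=
  match A (answers A L e t) with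
  | .call q => if orientation L q = orientation L' q then e t else !e t
  | .halt _ => e t

theorem answers_transferBits (A : DetAlgorithm n) {L L' : Fin n → Line}
    (hL : ∀ q, orientation L q ≠ 0) (hL' : ∀ q, orientation L' q ≠ 0) (e : ℕ → Bool) (t : ℕ) :
    answers A L' (transferBits A L L' e) t = answers A L e t := by
  induction t with
  | zero => rfl
  | succ t ih =>
    cases h : A (answers A L e t) with
    | halt out => rw [answers_succ_of_halt h, answers_succ_of_halt (ih.symm ▸ h), ih]
    | call q =>
      rw [answers_succ_of_call h, answers_succ_of_call (ih.symm ▸ h), ih]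
      congr 1
      simp only [transferBits, h, noisyOrientation]
      have h1 := hL q
      have h2 := hL' q
      revert h1 h2
      generalize orientation L q = o
      generalize orientation L' q = o'
      generalize e t = b
      revert o o' b
      decide

open Classical in
/-- The number of calls to the noisy test on triples in `S`. -/
noncomputable def numCallsOn (A : DetAlgorithm n) (L : Fin n → Line) (S : Set (Fin 3 ↪ Fin n))
    (e : ℕ → Bool) : ENNReal :=
  ∑' t, if ∃ q, A (answers A L e t) = .call q ∧ q ∈ S then 1 else 0

open Classical in
theorem card_filter_le_numCallsOn (A : DetAlgorithm n) (L : Fin n → Line)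
    (S : Set (Fin 3 ↪ Fin n)) (e : ℕ → Bool) (t : ℕ) :
    (((Finset.range t).filter fun i => ∃ q, A (answers A L e i) = .call q ∧ q ∈ S).card : ENNReal) ≤
      numCallsOn A L S e := by
  rw [← Finset.sum_boole, numCallsOn]
  exact ENNReal.sum_le_tsum _

theorem sum_numCallsOn_le (A : DetAlgorithm n) (L : Fin n → Line) {ι : Type*} (I : Finset ι)
    (S : ι → Set (Fin 3 ↪ Fin n)) (hS : ∀ q i j, q ∈ S i → q ∈ S j → i = j) (e : ℕ → Bool) :
    ∑ i ∈ I, numCallsOn A L (S i) e ≤ numCalls A L e := by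
  classical
  unfold numCallsOn numCalls
  rw [← Summable.tsum_finsetSum fun _ _ => ENNReal.summable]
  refine ENNReal.tsum_le_tsum fun t => ?_
  cases h : A (answers A L e t) with
  | halt out => simp
  | call q =>
    simp only [Action.call.injEq, exists_eq_left', exists_eq', if_true]
    rw [Finset.sum_boole]
    have : (I.filter fun i => q ∈ S i).card ≤ 1 := Finset.card_le_one.2 fun i hi j hj =>
      hS q i j (Finset.mem_filter.1 hi).2 (Finset.mem_filter.1 hj).2
    exact_mod_cast this

end Transcripts

/-! ### Likelihood ratio of a transcript on two inputs. -/

section Likelihood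

instance (p : unitInterval) : IsProbabilityMeasure (errorLaw p) := by
  unfold errorLaw
  infer_instance

/-- The probability that an error bit has the value `b`. -/
noncomputable def bitProb (p : unitInterval) (b : Bool) : ENNReal :=
  ProbabilityTheory.bernoulliMeasure true false p {b}

theorem bitProb_eq (p : unitInterval) (b : Bool) :
    bitProb p b = ENNReal.ofReal (if b then p else 1 - p) := by
  rw [bitProb, ProbabilityTheory.bernoulliMeasure_apply _ (measurableSet_singleton b)]
  cases b <;> simp [ENNReal.ofReal, unitInterval.toNNReal]
  · rw [Real.toNNReal_of_nonneg (sub_nonneg.2 p.2.2)]; rfl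
  · rw [Real.toNNReal_of_nonneg p.2.1]; rfl

theorem errorLaw_cylinder (p : unitInterval) (b : ℕ → Bool) (t : ℕ) :
    errorLaw p {e | ∀ i < t, e i = b i} = ∏ i ∈ Finset.range t, bitProb p (b i) := by
  have := Measure.infinitePi_pi (fun _ : ℕ => ProbabilityTheory.bernoulliMeasure true false p)
    (s := Finset.range t) (t := fun i => {b i}) (fun i _ => measurableSet_singleton _)
  rw [errorLaw, show {e : ℕ → Bool | ∀ i < t, e i = b i} =
    Set.pi (Finset.range t : Set ℕ) (fun i => {b i}) by ext; simp]
  exact this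

/-- The factor by which reversing one answer can decrease the likelihood. -/
noncomputable def oddsRatio (p : unitInterval) : ENNReal := ENNReal.ofReal (p / (1 - p))

/-- Equality holds when an error is introduced; when one is removed, the probability even increases
because `p < 1 / 2`. -/
theorem oddsRatio_mul_bitProb_le {p : unitInterval} (hp : (p : ℝ) < 1 / 2) (b : Bool) :
    oddsRatio p * bitProb p b ≤ bitProb p !b := by
  have h0 := p.2.1
  have h1 : (0 : ℝ) < 1 - p := by linarith
  rw [oddsRatio, bitProb_eq, bitProb_eq, ← ENNReal.ofReal_mul (by positivity)]
  refine ENNReal.ofReal_le_ofReal ?_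
  cases b
  · simp [h1.ne']
  · simp only [if_true, Bool.not_true, Bool.false_eq_true, if_false]
    rw [div_mul_eq_mul_div, div_le_iff₀ h1]
    nlinarith

theorem oddsRatio_le_one {p : unitInterval} (hp : (p : ℝ) < 1 / 2) : oddsRatio p ≤ 1 := by
  rw [oddsRatio, ENNReal.ofReal_le_one, div_le_one (by linarith)]
  linarith

variable {n : ℕ}

/-- If few of the calls of a transcript distinguish `L` from `L'`, then this transcript is not much
less likely on `L'` than on `L`. -/
theorem transcript_likelihood {p : unitInterval} (hp : (p : ℝ) < 1 / 2) (A : DetAlgorithm n)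
    {L L' : Fin n → Line} (hL : ∀ q, orientation L q ≠ 0) (hL' : ∀ q, orientation L' q ≠ 0)
    {h : List SignType} {e : ℕ → Bool} (he : answers A L e h.length = h) {K : ℕ}
    (hK : numCallsOn A L {q | orientation L q ≠ orientation L' q} e < K) :
    oddsRatio p ^ K * errorLaw p {e | answers A L e h.length = h} ≤
      errorLaw p {e | answers A L' e h.length = h} := by
  classical
  set t := h.length with ht
  set D : ℕ → Prop := fun i => ∃ q, A (answers A L e i) = .call q ∧
    q ∈ {q | orientation L q ≠ orientation L' q} with hD
  have hcard : ((Finset.range t).filter D).card ≤ K := by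
    exact_mod_cast (card_filter_le_numCallsOn A L _ e t).trans hK.le
  calc oddsRatio p ^ K * errorLaw p {e | answers A L e t = h}
      ≤ oddsRatio p ^ K * errorLaw p {e' | ∀ i < t, e' i = e i} := by
        refine mul_le_mul' le_rfl (measure_mono fun e' he' => ?_)
        exact fun i hi => (eq_of_answers_eq hL (he ▸ ht.symm) (he.trans he'.symm) i hi).symm
    _ = oddsRatio p ^ K * ∏ i ∈ Finset.range t, bitProb p (e i) := by rw [errorLaw_cylinder]
    _ ≤ oddsRatio p ^ ((Finset.range t).filter D).card *
          ∏ i ∈ Finset.range t, bitProb p (e i) := by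
        gcongr ?_ * _
        exact pow_le_pow_of_le_one zero_le (oddsRatio_le_one hp) hcard
    -- One factor of the odds ratio is allotted to each distinguishing call, exactly where
    -- `transferBits` reverses the error bit.
    _ = ∏ i ∈ Finset.range t, (if D i then oddsRatio p else 1) * bitProb p (e i) := by
        rw [Finset.prod_mul_distrib, Finset.prod_ite]
        simp
    _ ≤ ∏ i ∈ Finset.range t, bitProb p (transferBits A L L' e i) := by
        refine Finset.prod_le_prod' fun i _ => ?_
        by_cases hi : D i
        · rw [if_pos hi]
          obtain ⟨q, hq, hq'⟩ := hi
          have : transferBits A L L' e i = !e i := by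
            simp only [transferBits, hq]
            exact if_neg hq'
          rw [this]
          exact oddsRatio_mul_bitProb_le hp _
        · rw [if_neg hi, one_mul]
          have : transferBits A L L' e i = e i := by
            simp only [transferBits]
            cases hq : A (answers A L e i) with
            | halt out => rfl
            | call q =>
              refine if_pos ?_
              by_contra hne
              exact hi ⟨q, hq, hne⟩
          rw [this]
    _ = errorLaw p {e' | ∀ i < t, e' i = transferBits A L L' e i} := by rw [errorLaw_cylinder]
    _ ≤ errorLaw p {e | answers A L' e t = h} := by
        refine measure_mono fun e' he' => ?_
        exact (answers_congr A L' he').trans ((answers_transferBits A hL hL' e t).trans he)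

end Likelihood

/-! ### Measurability of runs in seed and noise. -/

section Measurability

instance (n : ℕ) : Finite (Action n) := by
  refine Finite.of_injective
    (fun a : Action n => match a with
      | .call q => (Sum.inl q : (Fin 3 ↪ Fin n) ⊕ Set (Fin n → SignType))
      | .halt out => Sum.inr out) ?_
  rintro (q | o) (q' | o') h <;> simp_all

variable {n : ℕ} {Ω : Type*} [MeasurableSpace Ω]

/-- There are countably many transcripts and finitely many actions and bits, so the event is a
countable union over their values. -/
theorem measurableSet_step_of_measurableSet_answers (R : RandAlgorithm n Ω) (L : Fin n → Line)
    (t : ℕ)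
    (ht : ∀ h, MeasurableSet {x : Ω × (ℕ → Bool) | answers (R.alg x.1) L x.2 t = h})
    (P : List SignType → Action n → Bool → Prop) :
    MeasurableSet {x : Ω × (ℕ → Bool) |
      P (answers (R.alg x.1) L x.2 t) (R.alg x.1 (answers (R.alg x.1) L x.2 t)) (x.2 t)} := by
  have : {x : Ω × (ℕ → Bool) |
      P (answers (R.alg x.1) L x.2 t) (R.alg x.1 (answers (R.alg x.1) L x.2 t)) (x.2 t)} =
      ⋃ (h) (a) (b), {x : Ω × (ℕ → Bool) | answers (R.alg x.1) L x.2 t = h} ∩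
        Prod.fst ⁻¹' {ω | R.alg ω h = a} ∩ {x | x.2 t = b} ∩ {_x | P h a b} := by
    ext x
    simp only [Set.mem_ofPred_eq, Set.mem_iUnion, Set.mem_inter_iff, Set.mem_preimage]
    constructor
    · exact fun hx => ⟨_, _, _, ⟨⟨rfl, rfl⟩, rfl⟩, hx⟩
    · rintro ⟨_, _, _, ⟨⟨rfl, rfl⟩, rfl⟩, hx⟩
      exact hx
  rw [this]
  refine MeasurableSet.iUnion fun h => MeasurableSet.iUnion fun a => MeasurableSet.iUnion fun b =>
    (((ht h).inter (measurable_fst (R.measurable_alg h a))).inter ?_).inter (.const _)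
  have hm : Measurable fun x : Ω × (ℕ → Bool) => x.2 t := by fun_prop
  exact hm (measurableSet_singleton b)

theorem measurableSet_answers_eq (R : RandAlgorithm n Ω) (L : Fin n → Line) (t : ℕ)
    (h : List SignType) :
    MeasurableSet {x : Ω × (ℕ → Bool) | answers (R.alg x.1) L x.2 t = h} := by
  induction t generalizing h with
  | zero =>
    simp only [answers]
    exact .const _
  | succ t ih =>
    exact measurableSet_step_of_measurableSet_answers R L t ih fun l a b =>
      (match a with
        | .call q => noisyOrientation L b q :: l
        | .halt _ => l) = h

theorem measurableSet_step (R : RandAlgorithm n Ω) (L : Fin n → Line) (t : ℕ)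
    (P : Action n → Prop) :
    MeasurableSet {x : Ω × (ℕ → Bool) | P (R.alg x.1 (answers (R.alg x.1) L x.2 t))} :=
  measurableSet_step_of_measurableSet_answers R L t (measurableSet_answers_eq R L t)
    fun _ a _ => P a

theorem measurableSet_haltsWith (R : RandAlgorithm n Ω) (L : Fin n → Line)
    (out : Set (Fin n → SignType)) :
    MeasurableSet {x : Ω × (ℕ → Bool) | HaltsWith (R.alg x.1) L x.2 out} := by
  simp only [HaltsWith, Set.ofPred_exists]
  exact MeasurableSet.iUnion fun t => measurableSet_step R L t fun a => a = .halt out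

theorem measurable_numCallsOn (R : RandAlgorithm n Ω) (L : Fin n → Line)
    (S : Set (Fin 3 ↪ Fin n)) :
    Measurable fun x : Ω × (ℕ → Bool) => numCallsOn (R.alg x.1) L S x.2 := by
  classical
  unfold numCallsOn
  exact Measurable.tsum fun t => Measurable.ite
    (measurableSet_step R L t fun a => ∃ q, a = .call q ∧ q ∈ S) measurable_const measurable_const

/-- A deterministic algorithm as a randomized algorithm with a trivial seed. -/
def DetAlgorithm.toRand (A : DetAlgorithm n) : RandAlgorithm n Unit where
  alg _ := A
  measurable_alg _ _ := .const _

theorem measurableSet_transcript (A : DetAlgorithm n) (L : Fin n → Line) (h : List SignType) :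
    MeasurableSet {e : ℕ → Bool | answers A L e h.length = h} :=
  (measurable_prodMk_left (x := ())) (measurableSet_answers_eq A.toRand L h.length h)

end Measurability

/-! ### Change of measure and the count of calls. -/

section ChangeOfMeasure

variable {n : ℕ}

theorem haltsWith_likelihood {p : unitInterval} (hp : (p : ℝ) < 1 / 2) (A : DetAlgorithm n)
    {L L' : Fin n → Line} (hL : ∀ q, orientation L q ≠ 0) (hL' : ∀ q, orientation L' q ≠ 0)
    (out : Set (Fin n → SignType)) (K : ℕ) :
    oddsRatio p ^ K * errorLaw p {e | HaltsWith A L e out ∧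
      numCallsOn A L {q | orientation L q ≠ orientation L' q} e < K} ≤
      errorLaw p {e | HaltsWith A L' e out} := by
  set H : Set (List SignType) := {h | A h = .halt out ∧ ∃ e, answers A L e h.length = h ∧
    numCallsOn A L {q | orientation L q ≠ orientation L' q} e < K} with hH
  calc _ ≤ oddsRatio p ^ K *
        errorLaw p (⋃ h : H, {e | answers A L e h.1.length = h.1}) := by
        refine mul_le_mul' le_rfl (measure_mono fun e he => ?_)
        obtain ⟨h, h1, h2⟩ := haltsWith_iff.1 he.1
        exact Set.mem_iUnion.2 ⟨⟨h, h1, e, h2, he.2⟩, h2⟩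
    _ ≤ oddsRatio p ^ K * ∑' h : H, errorLaw p {e | answers A L e h.1.length = h.1} :=
        mul_le_mul' le_rfl (measure_iUnion_le _)
    _ = ∑' h : H, oddsRatio p ^ K * errorLaw p {e | answers A L e h.1.length = h.1} :=
        ENNReal.tsum_mul_left.symm
    _ ≤ ∑' h : H, errorLaw p {e | answers A L' e h.1.length = h.1} := by
        refine ENNReal.tsum_le_tsum fun h => ?_
        obtain ⟨e, he, hK⟩ := h.2.2
        exact transcript_likelihood hp A hL hL' he hK
    _ ≤ errorLaw p (⋃ h : H, {e | answers A L' e h.1.length = h.1}) := by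
        -- A run has only one halting transcript, so the events on `L'` are disjoint and the
        -- termwise bounds can be summed.
        refine tsum_meas_le_meas_iUnion_of_disjoint _
          (fun h => measurableSet_transcript A L' h.1) fun h h' hne => ?_
        refine Set.disjoint_left.2 fun e he he' => hne (Subtype.ext ?_)
        have he : answers A L' e h.1.length = h.1 := he
        have he' : answers A L' e h'.1.length = h'.1 := he'
        rw [← he, ← he']
        exact answers_eq_answers_of_halt (he.symm ▸ h.2.1) (he'.symm ▸ h'.2.1)
    _ ≤ errorLaw p {e | HaltsWith A L' e out} := by
        refine measure_mono (Set.iUnion_subset fun h e he => ?_)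
        exact haltsWith_iff.2 ⟨h.1, h.2.1, he⟩

variable {Ω : Type*} [MeasurableSpace Ω]

theorem measurableSet_haltsWith_and_numCallsOn_lt (R : RandAlgorithm n Ω) (L : Fin n → Line)
    (out : Set (Fin n → SignType)) (S : Set (Fin 3 ↪ Fin n)) (K : ENNReal) :
    MeasurableSet {x : Ω × (ℕ → Bool) | HaltsWith (R.alg x.1) L x.2 out ∧
      numCallsOn (R.alg x.1) L S x.2 < K} :=
  (measurableSet_haltsWith R L out).inter
    (measurableSet_lt (measurable_numCallsOn R L S) measurable_const)

theorem haltsWith_likelihood_rand {p : unitInterval} (hp : (p : ℝ) < 1 / 2) (μ : Measure Ω)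
    [SFinite μ] (R : RandAlgorithm n Ω)
    {L L' : Fin n → Line} (hL : ∀ q, orientation L q ≠ 0) (hL' : ∀ q, orientation L' q ≠ 0)
    (out : Set (Fin n → SignType)) (K : ℕ) :
    oddsRatio p ^ K * μ.prod (errorLaw p) {x | HaltsWith (R.alg x.1) L x.2 out ∧
      numCallsOn (R.alg x.1) L {q | orientation L q ≠ orientation L' q} x.2 < K} ≤
      μ.prod (errorLaw p) {x | HaltsWith (R.alg x.1) L' x.2 out} := by
  have hm := measurableSet_haltsWith_and_numCallsOn_lt R L out
    {q | orientation L q ≠ orientation L' q} K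
  rw [Measure.prod_apply hm, Measure.prod_apply (measurableSet_haltsWith R L' out),
    ← lintegral_const_mul _ (measurable_measure_prodMk_left hm)]
  exact lintegral_mono fun ω => haltsWith_likelihood hp (R.alg ω) hL hL' out K

/-- An algorithm that is reliable on two inputs with different arrangements often makes many calls
that distinguish these inputs. -/
theorem quarter_le_prob_numCallsOn {p : unitInterval} (hp : (p : ℝ) < 1 / 2) (μ : Measure Ω)
    [IsProbabilityMeasure μ] (R : RandAlgorithm n Ω) {L L' : Fin n → Line}
    (hL : ∀ q, orientation L q ≠ 0) (hL' : ∀ q, orientation L' q ≠ 0)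
    (hne : arrangement L ≠ arrangement L') {δ : ℝ} (hs : 1 - δ ≤ successProb μ p R L)
    (hs' : 1 - δ ≤ successProb μ p R L') (hδ : δ ≤ 1 / 4) {K : ℕ}
    (hK : δ < ((p : ℝ) / (1 - p)) ^ K / 2) :
    1 / 4 ≤ (μ.prod (errorLaw p)).real {x | (K : ENNReal) ≤
      numCallsOn (R.alg x.1) L {q | orientation L q ≠ orientation L' q} x.2} := by
  -- Otherwise the run on `L` is correct with fewer than `K` distinguishing calls with probability
  -- at least `3 / 4 - 1 / 4 = 1 / 2`, so on `L'` it outputs the wrong arrangement with probability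
  -- at least `r ^ K / 2 > δ`.
  by_contra! hlt
  set P := μ.prod (errorLaw p)
  have hr : 0 ≤ (p : ℝ) / (1 - p) := div_nonneg p.2.1 (by linarith)
  have h1 : (1 : ℝ) / 2 ≤ P.real {x | HaltsWith (R.alg x.1) L x.2 (arrangement L) ∧
      numCallsOn (R.alg x.1) L {q | orientation L q ≠ orientation L' q} x.2 < K} := by
    have hsub : {x : Ω × (ℕ → Bool) | HaltsWith (R.alg x.1) L x.2 (arrangement L)} ⊆
        {x | HaltsWith (R.alg x.1) L x.2 (arrangement L) ∧
          numCallsOn (R.alg x.1) L {q | orientation L q ≠ orientation L' q} x.2 < K} ∪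
        {x | (K : ENNReal) ≤
          numCallsOn (R.alg x.1) L {q | orientation L q ≠ orientation L' q} x.2} :=
      fun x hx => (lt_or_ge _ _).imp (fun h => ⟨hx, h⟩) id
    have h2 := (measureReal_mono hsub).trans (measureReal_union_le (μ := P) _ _)
    have h3 : 1 - δ ≤ P.real {x | HaltsWith (R.alg x.1) L x.2 (arrangement L)} := hs
    linarith
  have h2 : ((p : ℝ) / (1 - p)) ^ K * P.real {x | HaltsWith (R.alg x.1) L x.2 (arrangement L) ∧
      numCallsOn (R.alg x.1) L {q | orientation L q ≠ orientation L' q} x.2 < K} ≤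
      P.real {x | HaltsWith (R.alg x.1) L' x.2 (arrangement L)} := by
    have := ENNReal.toReal_mono (measure_ne_top _ _)
      (haltsWith_likelihood_rand hp μ R hL hL' (arrangement L) K)
    rwa [ENNReal.toReal_mul, ENNReal.toReal_pow, oddsRatio, ENNReal.toReal_ofReal hr] at this
  have h3 : P.real {x | HaltsWith (R.alg x.1) L' x.2 (arrangement L)} +
      P.real {x | HaltsWith (R.alg x.1) L' x.2 (arrangement L')} ≤ 1 := by
    have hd : Disjoint {x : Ω × (ℕ → Bool) | HaltsWith (R.alg x.1) L' x.2 (arrangement L)}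
        {x | HaltsWith (R.alg x.1) L' x.2 (arrangement L')} :=
      Set.disjoint_left.2 fun x hx hx' => hne (HaltsWith.unique hx hx')
    rw [← measureReal_union hd (measurableSet_haltsWith R L' _)]
    exact measureReal_le_one
  have h4 : 1 - δ ≤ P.real {x | HaltsWith (R.alg x.1) L' x.2 (arrangement L')} := hs'
  have h5 := mul_le_mul_of_nonneg_left h1 (pow_nonneg hr K)
  linarith

/-- If an input has `s` neighbours, differing from it on pairwise disjoint sets of triples, then a
reliable algorithm makes at least `s K / 4` calls on it. -/
theorem card_mul_le_expectedCalls {p : unitInterval} (hp : (p : ℝ) < 1 / 2) (μ : Measure Ω)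
    [IsProbabilityMeasure μ] (R : RandAlgorithm n Ω) {L : Fin n → Line} (hL : IsSimpleSorted L)
    {ι : Type*} (I : Finset ι) (L' : ι → Fin n → Line) (hL' : ∀ i ∈ I, IsSimpleSorted (L' i))
    (hne : ∀ i ∈ I, arrangement L ≠ arrangement (L' i))
    (hdisj : ∀ q i j, orientation L q ≠ orientation (L' i) q →
      orientation L q ≠ orientation (L' j) q → i = j) {δ : ℝ}
    (hs : ∀ L : Fin n → Line, IsSimpleSorted L → 1 - δ ≤ successProb μ p R L)
    (hδ : δ ≤ 1 / 4) {K : ℕ} (hK : δ < ((p : ℝ) / (1 - p)) ^ K / 2) :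
    ENNReal.ofReal (I.card * (K * (1 / 4))) ≤ expectedCalls μ p R L := by
  set S : ι → Set (Fin 3 ↪ Fin n) := fun i => {q | orientation L q ≠ orientation (L' i) q}
  calc ENNReal.ofReal (I.card * (K * (1 / 4)))
      = ∑ i ∈ I, (K : ENNReal) * ENNReal.ofReal (1 / 4) := by
        rw [Finset.sum_const, nsmul_eq_mul, ENNReal.ofReal_mul (by positivity),
          ENNReal.ofReal_mul (by positivity), ENNReal.ofReal_natCast, ENNReal.ofReal_natCast]
    _ ≤ ∑ i ∈ I, ∫⁻ x, numCallsOn (R.alg x.1) L (S i) x.2 ∂(μ.prod (errorLaw p)) := by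
        refine Finset.sum_le_sum fun i hi => ?_
        -- Markov's inequality at level `K`.
        refine le_trans ?_ (mul_meas_ge_le_lintegral (measurable_numCallsOn R L (S i)) K)
        refine mul_le_mul' le_rfl (ENNReal.ofReal_le_of_le_toReal ?_)
        exact quarter_le_prob_numCallsOn hp μ R hL.orientation_ne_zero
          (hL' i hi).orientation_ne_zero (hne i hi) (hs _ hL) (hs _ (hL' i hi)) hδ hK
    _ = ∫⁻ x, ∑ i ∈ I, numCallsOn (R.alg x.1) L (S i) x.2 ∂(μ.prod (errorLaw p)) :=
        (lintegral_finsetSum _ fun i _ => measurable_numCallsOn R L (S i)).symm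
    _ ≤ expectedCalls μ p R L :=
        lintegral_mono fun x => sum_numCallsOn_le _ _ _ _ hdisj _

end ChangeOfMeasure

/-! ### Choice of constants and conclusion. -/

theorem natCast_div_eight_le (n : ℕ) (hn : 8 ≤ n) : (n : ℝ) / 8 ≤ ((n - 1) / 4 : ℕ) := by
  have h : n ≤ 8 * ((n - 1) / 4) := by omega
  have : (n : ℝ) ≤ 8 * ((n - 1) / 4 : ℕ) := by exact_mod_cast h
  linarith

end NoisyArrangement

open NoisyArrangement in
theorem mainTheorem6 (p : unitInterval) (hp0 : 0 < (p : ℝ)) (hp : (p : ℝ) < 1 / 2)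
    (c : ℝ) (hc : 0 < c) :
    ∃ κ : ℝ, 0 < κ ∧ ∃ N : ℕ, ∀ n : ℕ, N ≤ n →
      ∀ (Ω : Type*) [MeasurableSpace Ω] (μ : MeasureTheory.Measure Ω)
        [MeasureTheory.IsProbabilityMeasure μ] (R : RandAlgorithm n Ω),
        (∀ L : Fin n → Line, IsSimpleSorted L → 1 - (n : ℝ) ^ (-c) ≤ successProb μ p R L) →
        ∃ L : Fin n → Line, IsSimpleSorted L ∧
          ENNReal.ofReal (κ * (n : ℝ) ^ 2 * Real.log n) ≤ expectedCalls μ p R L := by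
  set r : ℝ := (p : ℝ) / (1 - p) with hr
  have hr0 : 0 < r := div_pos hp0 (by linarith)
  have hr1 : r < 1 := by rw [hr, div_lt_one (by linarith)]; linarith
  have hlog : Real.log r < 0 := Real.log_neg hr0 hr1
  -- Chosen so that `r ^ (κ' * log n) = n ^ (-c / 2)`.
  set κ' : ℝ := c / (2 * -Real.log r) with hκ'
  have hκ'0 : 0 < κ' := div_pos hc (by linarith)
  -- 256 is `8 * 8 * 4`: `m ≥ n / 8` enters squared, and each neighbour contributes `K / 4`.
  refine ⟨κ' / 256, by positivity, ?_⟩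
  have htend : ∀ a : ℝ, 0 < a →
      Filter.Tendsto (fun n : ℕ => (n : ℝ) ^ (-a)) Filter.atTop (nhds 0) := fun a ha =>
    (tendsto_rpow_neg_atTop ha).comp tendsto_natCast_atTop_atTop
  obtain ⟨N, hN⟩ := Filter.eventually_atTop.1
    (((htend c hc).eventually_lt_const (by norm_num : (0 : ℝ) < 1 / 4)).and
      (((htend (c / 2) (half_pos hc)).eventually_lt_const (half_pos hr0)).and
        (Filter.eventually_ge_atTop 8)))
  refine ⟨N, fun n hn Ω _ μ _ R hs => ?_⟩
  obtain ⟨h1, h2, h8⟩ := hN n hn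
  set m := (n - 1) / 4 with hm
  have hmn : 4 * m + 1 ≤ n := by omega
  have hn0 : (0 : ℝ) < n := by exact_mod_cast (by omega : 0 < n)
  have hlogn : 0 ≤ Real.log n := Real.log_natCast_nonneg n
  refine ⟨_, isSimpleSorted_base hmn, ?_⟩
  set K := ⌊κ' * Real.log n⌋₊ + 1 with hKdef
  have hK1 : κ' * Real.log n ≤ K := by
    rw [hKdef]; push_cast; exact (Nat.lt_floor_add_one _).le
  have hK2 : (K : ℝ) ≤ κ' * Real.log n + 1 := by
    rw [hKdef]; push_cast; gcongr; exact Nat.floor_le (by positivity)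
  -- Rounding up to `K` costs at most one factor `r`, so `r ^ K ≥ r * n ^ (-c / 2)`. The spare
  -- factor `n ^ (-c / 2) < r / 2` absorbs both `r` and the 2.
  have hK : (n : ℝ) ^ (-c) < r ^ K / 2 := by
    have e1 : r * (n : ℝ) ^ (-(c / 2)) ≤ r ^ K := by
      calc r * (n : ℝ) ^ (-(c / 2)) = r ^ (κ' * Real.log n + 1) := by
            rw [Real.rpow_add hr0, Real.rpow_one, mul_comm, Real.rpow_def_of_pos hr0,
              Real.rpow_def_of_pos hn0]
            congr 2
            rw [hκ']
            field_simp [hlog.ne]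
        _ ≤ r ^ (K : ℝ) := Real.rpow_le_rpow_of_exponent_ge hr0 hr1.le hK2
        _ = r ^ K := Real.rpow_natCast r K
    have e2 : (n : ℝ) ^ (-c) = (n : ℝ) ^ (-(c / 2)) * (n : ℝ) ^ (-(c / 2)) := by
      rw [← Real.rpow_add hn0]; congr 1; ring
    have e3 := mul_lt_mul_of_pos_right h2 (Real.rpow_pos_of_pos hn0 (-(c / 2)))
    linarith
  refine le_trans (ENNReal.ofReal_le_ofReal ?_)
    (card_mul_le_expectedCalls hp μ R (isSimpleSorted_base hmn)
      (Finset.range m ×ˢ Finset.range m) (fun i => cubicLines n m (flipShift n m i.1 i.2))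
      (fun i _ => isSimpleSorted_flip hmn i.1 i.2)
      (fun i hi => by
        rw [Finset.mem_product, Finset.mem_range, Finset.mem_range] at hi
        exact arrangement_base_ne_flip hmn hi.1 hi.2)
      (fun q i j hi hj => eq_of_mem_flippedTriples hmn hi hj) hs h1.le hK)
  rw [Finset.card_product, Finset.card_range]
  push_cast
  have hmr : (n : ℝ) / 8 ≤ m := natCast_div_eight_le n h8
  calc κ' / 256 * (n : ℝ) ^ 2 * Real.log n
      = ((n : ℝ) / 8 * (n / 8)) * (κ' * Real.log n * (1 / 4)) := by ring
    _ ≤ (m * m) * (K * (1 / 4)) := by gcongr
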